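/- Let $X$ be a compact metric space. For a finite open cover $\alpha$ of a compact space $Y$ put $$\operatorname{ord}(\alpha)=\sup_{x\in Y}\#\{U\in\alpha : x\in U\}-1,\qquad \mathcal D(\alpha)=\min_{\beta\succ\alpha}\operatorname{ord}(\beta),$$ where $\beta$ runs over the finite open covers of $Y$ that refine $\alpha$ (if $Y=\emptyset$, the supremum is $0$). Let $\dim(Y)=\sup_\alpha\mathcal D(\alpha)$ be the topological dimension of $Y$ and, for a continuous map $\phi:Y\to Y$, let $$\operatorname{mdim}(Y,\phi)=\sup_{\alpha}\lim_{n\to\infty}\frac{\mathcal D\big(\alpha\vee\phi^{-1}(\alpha)\vee\dots\vee\phi^{-(n-1)}(\alpha)\big)}{n}\in[0,\infty]$$ be its mean dimension, the suprema being over all finite open covers $\alpha$ of $Y$. Let $\mathbb K=\mathbb N$ or $\mathbb Z$, endow $X^{\mathbb K}$ with the product topology, and endow the set $C^0(X^{\mathbb K})$ of all continuous maps $X^{\mathbb K}\to X^{\mathbb K}$ with the topology of uniform convergence. Suppose that $\dim(X)<\infty$. Then: 1. The set $\{\phi\in C^0(X^{\mathbb K}) : \operatorname{mdim}(X^{\mathbb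 K},\phi)=0\}$ is dense in $C^0(X^{\mathbb K})$. 2. For every $a\in[0,\infty]$: if there is $\psi\in C^0(X^{\mathbb K})$ with $\operatorname{mdim}(X^{\mathbb K},\psi)=a$, then the set $\{\phi\in C^0(X^{\mathbb K}) : \operatorname{mdim}(X^{\mathbb K},\phi)=a\}$ is dense in $C^0(X^{\mathbb K})$. 3. The function $\phi\mapsto\operatorname{mdim}(X^{\mathbb K},\phi)$ from $C^0(X^{\mathbb K})$ to $\mathbb R\cup\{\infty\}$ is either constant, or discontinuous at every point of $C^0(X^{\mathbb K})$. -/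

import Mathlib

open Set Filter

noncomputable section

namespace MeanDim

/-- `α` is a finite open cover of `Y`. -/
structure IsFiniteOpenCover {Y : Type*} [TopologicalSpace Y] (α : Set (Set Y)) : Prop where
  finite : α.Finite
  isOpen : ∀ U ∈ α, IsOpen U
  sUnion_eq : ⋃₀ α = univ

/-- `β ≻ α`: every member of `β` is contained in a member of `α`. -/
def Refines {Y : Type*} (β α : Set (Set Y)) : Prop :=
  ∀ V ∈ β, ∃ U ∈ α, V ⊆ U

/-- `ord(α) = sup_x (∑_{U ∈ α} 1_U(x)) - 1`: the largest number of members of `α` with a common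
point, minus one.  For a finite family `α` the supremum is bounded by the cardinality of `α`;
on the empty space it is `0`, so that the order is `-1`. -/
def ord {Y : Type*} (α : Set (Set Y)) : ℤ :=
  ((⨆ x : Y, {U ∈ α | x ∈ U}.ncard : ℕ) : ℤ) - 1

/-- `𝒟(α)`: the minimum of `ord(β)` over all finite open covers `β` finer than `α`.  If `α` is a
finite open cover, then this is the infimum of a nonempty set of integers `≥ -1`, hence it is
attained. -/
def covD {Y : Type*} [TopologicalSpace Y] (α : Set (Set Y)) : ℤ :=
  sInf {k : ℤ | ∃ β : Set (Set Y), IsFiniteOpenCover β ∧ Refines β α ∧ ord β = k}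

/-- The topological (covering) dimension `dim(Y) = sup_α 𝒟(α)`. -/
def topDim (Y : Type*) [TopologicalSpace Y] : EReal :=
  ⨆ (α : Set (Set Y)) (_ : IsFiniteOpenCover α), ((covD α : ℝ) : EReal)

/-- `α_0^{n-1} = α ∨ φ⁻¹(α) ∨ ⋯ ∨ φ^{-n+1}(α)`: all sets
`A_0 ∩ φ⁻¹(A_1) ∩ ⋯ ∩ φ^{-(n-1)}(A_{n-1})` with `A_0, …, A_{n-1} ∈ α`. -/
def dynJoin {Y : Type*} (φ : Y → Y) (α : Set (Set Y)) (n : ℕ) : Set (Set Y) :=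
  {S | ∃ A : Fin n → Set Y, (∀ i, A i ∈ α) ∧ S = ⋂ i : Fin n, (φ^[(i : ℕ)]) ⁻¹' (A i)}

/-- The mean dimension `mdim(Y, φ) = sup_α lim_{n → ∞} 𝒟(α_0^{n-1}) / n`.  On a compact metric
space `n ↦ 𝒟(α_0^{n-1})` is subadditive, so the limit exists; it is written as an upper limit,
which has the same value and needs no existence proof in the definition. -/
def mdim {Y : Type*} [TopologicalSpace Y] (φ : C(Y, Y)) : EReal :=
  ⨆ (α : Set (Set Y)) (_ : IsFiniteOpenCover α),
    limsup (fun n : ℕ => (((covD (dynJoin φ α n) : ℝ) / (n : ℝ) : ℝ) : EReal)) atTop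

end MeanDim

end

/-!
Split off the coordinates in a finite set `E ⊆ K`: since `K` is infinite,
`X^K ≅ X^E × X^(K ∖ E) ≅ X^E × X^K`.  On this product let `θ` act as the `E`-part of `φ` (with
the coordinates outside `E` fixed) on the first factor and as `ψ` on the second.  As `E` grows,
`θ` tends uniformly to `φ`; on the other hand `X^E` is finite-dimensional, hence contributes no
mean dimension, and `mdim θ = mdim ψ`.  So every value of `mdim` is attained on a dense set; the
value `0` is attained by the identity, and a second value forces discontinuity everywhere.

The dimension theory behind this is the subadditivity `𝒟(α ∨ β) ≤ 𝒟(α) + 𝒟(β)`.  Partitions of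
unity subordinate to refinements of order `k` and `l` divide `[0, 1)`, at each point of the space,
into at most `k + 1` and at most `l + 1` intervals; at most `k + l + 1` pairs of these intervals
overlap, and the pairs index a refinement of `α ∨ β` of order at most `k + l`.
-/

namespace MeanDim

open Topology Uniformity Function

section Covers

variable {Y Z : Type*}

/-- The join `α ∨ β` of two covers: all intersections `A ∩ B` with `A ∈ α` and `B ∈ β`. -/
def join (α β : Set (Set Y)) : Set (Set Y) := image2 (· ∩ ·) α β

/-- The cover of `Y × Z` by the boxes `A ×ˢ B` with `A ∈ α` and `B ∈ β`. -/
def boxCover (α : Set (Set Y)) (β : Set (Set Z)) : Set (Set (Y × Z)) := image2 (· ×ˢ ·) α β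

theorem boxCover_eq_join (α : Set (Set Y)) (β : Set (Set Z)) :
    boxCover α β = join (preimage Prod.fst '' α) (preimage Prod.snd '' β) := by
  simp only [boxCover, join, image2_image_left, image2_image_right, Set.prod_eq]

theorem Refines.refl (α : Set (Set Y)) : Refines α α := fun V hV => ⟨V, hV, Subset.rfl⟩

theorem Refines.trans {α β γ : Set (Set Y)} (h : Refines α β) (h' : Refines β γ) :
    Refines α γ := fun V hV =>
  let ⟨U, hU, hVU⟩ := h V hV
  let ⟨W, hW, hUW⟩ := h' U hU
  ⟨W, hW, hVU.trans hUW⟩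

theorem Refines.join {α β α' β' : Set (Set Y)} (h : Refines α α') (h' : Refines β β') :
    Refines (join α β) (join α' β') := by
  rintro _ ⟨A, hA, B, hB, rfl⟩
  obtain ⟨A', hA', hAA'⟩ := h A hA
  obtain ⟨B', hB', hBB'⟩ := h' B hB
  exact ⟨_, mem_image2_of_mem hA' hB', inter_subset_inter hAA' hBB'⟩

theorem Refines.preimage {α β : Set (Set Z)} (h : Refines α β) (f : Y → Z) :
    Refines (preimage f '' α) (preimage f '' β) := by
  rintro _ ⟨V, hV, rfl⟩
  obtain ⟨U, hU, hVU⟩ := h V hV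
  exact ⟨_, mem_image_of_mem _ hU, preimage_mono hVU⟩

theorem Refines.dynJoin {α β : Set (Set Y)} (h : Refines α β) (φ : Y → Y) (n : ℕ) :
    Refines (dynJoin φ α n) (dynJoin φ β n) := by
  rintro _ ⟨A, hA, rfl⟩
  choose B hB hAB using fun i => h (A i) (hA i)
  exact ⟨_, ⟨B, hB, rfl⟩, iInter_mono fun i => preimage_mono (hAB i)⟩

theorem refines_dynJoin_id (α : Set (Set Y)) (n : ℕ) : Refines α (dynJoin id α n) := fun U hU =>
  ⟨_, ⟨fun _ => U, fun _ => hU, rfl⟩, subset_iInter fun i => by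
    simp only [iterate_id, preimage_id, Subset.rfl]⟩

theorem boxCover_dynJoin_refines (α : Set (Set Y)) (β : Set (Set Z)) (φ : Y → Y) (ψ : Z → Z)
    (n : ℕ) :
    Refines (boxCover (dynJoin φ α n) (dynJoin ψ β n))
      (dynJoin (Prod.map φ ψ) (boxCover α β) n) := by
  rintro _ ⟨_, ⟨A, hA, rfl⟩, _, ⟨B, hB, rfl⟩, rfl⟩
  refine ⟨_, ⟨fun i => A i ×ˢ B i, fun i => mem_image2_of_mem (hA i) (hB i), rfl⟩, ?_⟩
  rintro ⟨y, z⟩ ⟨hy, hz⟩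
  refine mem_iInter.2 fun i => ?_
  rw [Prod.map_iterate]
  exact ⟨mem_iInter.1 hy i, mem_iInter.1 hz i⟩

theorem dynJoin_preimage {p : Y → Z} {φ : Y → Y} {ψ : Z → Z} (h : Semiconj p φ ψ)
    (α : Set (Set Z)) (n : ℕ) :
    dynJoin φ (preimage p '' α) n = preimage p '' dynJoin ψ α n := by
  have preimage_iInter_iterate (A : Fin n → Set Z) :
      p ⁻¹' (⋂ i : Fin n, ψ^[i] ⁻¹' A i) = ⋂ i : Fin n, φ^[i] ⁻¹' (p ⁻¹' A i) := by
    simp only [preimage_iInter, ← preimage_comp, (h.iterate_right _).comp_eq]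
  ext S
  constructor
  · rintro ⟨A, hA, rfl⟩
    choose B hB hBA using hA
    obtain rfl : (fun i => p ⁻¹' B i) = A := funext hBA
    exact ⟨_, ⟨B, hB, rfl⟩, preimage_iInter_iterate B⟩
  · rintro ⟨_, ⟨B, hB, rfl⟩, rfl⟩
    exact ⟨_, fun i => mem_image_of_mem _ (hB i), preimage_iInter_iterate B⟩

theorem neg_one_le_ord (α : Set (Set Y)) : -1 ≤ ord α := by
  unfold ord
  omega

theorem ord_le_of_forall {α : Set (Set Y)} {k : ℤ} (hk : -1 ≤ k)
    (h : ∀ x, ({U ∈ α | x ∈ U}.ncard : ℤ) ≤ k + 1) : ord α ≤ k := by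
  have : (⨆ x : Y, {U ∈ α | x ∈ U}.ncard) ≤ (k + 1).toNat :=
    ciSup_le' fun x => by have := h x; omega
  unfold ord
  omega

theorem ncard_le_ord_add_one {α : Set (Set Y)} (hα : α.Finite) (x : Y) :
    ({U ∈ α | x ∈ U}.ncard : ℤ) ≤ ord α + 1 := by
  have bdd : BddAbove (range fun x : Y => {U ∈ α | x ∈ U}.ncard) :=
    ⟨α.ncard, forall_mem_range.2 fun _ => ncard_le_ncard (sep_subset _ _) hα⟩
  have := le_ciSup bdd x
  unfold ord
  omega

theorem ncard_image_sep_mem_le {ι : Type*} {s : Set ι} (hs : s.Finite) (W : ι → Set Y) (x : Y) :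
    {U ∈ W '' s | x ∈ U}.ncard ≤ {i ∈ s | x ∈ W i}.ncard := by
  have hfin : {i ∈ s | x ∈ W i}.Finite := hs.subset (sep_subset _ _)
  refine (ncard_le_ncard ?_ (hfin.image W)).trans (ncard_image_le hfin)
  rintro _ ⟨⟨i, hi, rfl⟩, hx⟩
  exact mem_image_of_mem W ⟨hi, hx⟩

theorem ord_range_le {ι : Type*} [Finite ι] {W : ι → Set Y} {k : ℤ} (hk : -1 ≤ k)
    (h : ∀ x, ({i | x ∈ W i}.ncard : ℤ) ≤ k + 1) : ord (range W) ≤ k := by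
  refine ord_le_of_forall hk fun x => le_trans ?_ (h x)
  simpa only [image_univ, mem_univ, true_and] using
    Nat.cast_le.2 (ncard_image_sep_mem_le finite_univ W x)

theorem ord_preimage_le {α : Set (Set Z)} (hα : α.Finite) (f : Y → Z) :
    ord (preimage f '' α) ≤ ord α :=
  ord_le_of_forall (neg_one_le_ord α) fun x =>
    (Nat.cast_le.2 (ncard_image_sep_mem_le hα (preimage f) x)).trans
      (ncard_le_ord_add_one hα (f x))

end Covers

section CoveringNumber

variable {Y Z : Type*} [TopologicalSpace Y] [TopologicalSpace Z]

theorem isFiniteOpenCover_univ : IsFiniteOpenCover ({univ} : Set (Set Y)) where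
  finite := finite_singleton _
  isOpen := by rintro _ rfl; exact isOpen_univ
  sUnion_eq := sUnion_singleton _

theorem IsFiniteOpenCover.exists_mem {α : Set (Set Y)} (hα : IsFiniteOpenCover α) (y : Y) :
    ∃ U ∈ α, y ∈ U :=
  mem_sUnion.1 (hα.sUnion_eq.ge (mem_univ y))

theorem IsFiniteOpenCover.preimage {α : Set (Set Z)} (hα : IsFiniteOpenCover α) {f : Y → Z}
    (hf : Continuous f) : IsFiniteOpenCover (preimage f '' α) where
  finite := hα.finite.image _
  isOpen := by
    rintro _ ⟨U, hU, rfl⟩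
    exact (hα.isOpen U hU).preimage hf
  sUnion_eq := by
    rw [sUnion_image, ← preimage_iUnion₂, ← sUnion_eq_biUnion, hα.sUnion_eq, preimage_univ]

theorem IsFiniteOpenCover.boxCover {α : Set (Set Y)} {β : Set (Set Z)}
    (hα : IsFiniteOpenCover α) (hβ : IsFiniteOpenCover β) :
    IsFiniteOpenCover (boxCover α β) where
  finite := hα.finite.image2 _ hβ.finite
  isOpen := by
    rintro _ ⟨U, hU, V, hV, rfl⟩
    exact (hα.isOpen U hU).prod (hβ.isOpen V hV)
  sUnion_eq := by
    refine eq_univ_of_forall fun ⟨y, z⟩ => ?_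
    obtain ⟨U, hU, hyU⟩ := hα.exists_mem y
    obtain ⟨V, hV, hzV⟩ := hβ.exists_mem z
    exact ⟨U ×ˢ V, mem_image2_of_mem hU hV, hyU, hzV⟩

theorem IsFiniteOpenCover.dynJoin {α : Set (Set Y)} (hα : IsFiniteOpenCover α) {φ : Y → Y}
    (hφ : Continuous φ) (n : ℕ) : IsFiniteOpenCover (dynJoin φ α n) where
  finite := by
    refine ((Set.Finite.pi' fun _ : Fin n => hα.finite).image
      fun A => ⋂ i : Fin n, φ^[i] ⁻¹' A i).subset ?_
    rintro _ ⟨A, hA, rfl⟩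
    exact ⟨A, hA, rfl⟩
  isOpen := by
    rintro _ ⟨A, hA, rfl⟩
    exact isOpen_iInter_of_finite fun i => (hα.isOpen _ (hA i)).preimage (hφ.iterate _)
  sUnion_eq := by
    refine eq_univ_of_forall fun x => ?_
    choose U hU hxU using hα.exists_mem
    exact ⟨_, ⟨fun i => U (φ^[i] x), fun i => hU _, rfl⟩, mem_iInter.2 fun i => hxU _⟩

theorem bddBelow_ord_refinements (α : Set (Set Y)) :
    BddBelow {k : ℤ | ∃ β : Set (Set Y), IsFiniteOpenCover β ∧ Refines β α ∧ ord β = k} :=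
  ⟨-1, by rintro _ ⟨β, -, -, rfl⟩; exact neg_one_le_ord β⟩

theorem covD_le_ord {α β : Set (Set Y)} (hβ : IsFiniteOpenCover β) (h : Refines β α) :
    covD α ≤ ord β :=
  csInf_le (bddBelow_ord_refinements α) ⟨β, hβ, h, rfl⟩

theorem IsFiniteOpenCover.exists_ord_eq_covD {α : Set (Set Y)} (hα : IsFiniteOpenCover α) :
    ∃ β, IsFiniteOpenCover β ∧ Refines β α ∧ ord β = covD α :=
  Int.csInf_mem (s := {k | ∃ β, IsFiniteOpenCover β ∧ Refines β α ∧ ord β = k})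
    ⟨_, α, hα, .refl α, rfl⟩ (bddBelow_ord_refinements α)

theorem IsFiniteOpenCover.neg_one_le_covD {α : Set (Set Y)} (hα : IsFiniteOpenCover α) :
    -1 ≤ covD α := by
  obtain ⟨β, -, -, hβα⟩ := hα.exists_ord_eq_covD
  exact hβα ▸ neg_one_le_ord β

theorem IsFiniteOpenCover.covD_le_of_refines {α β : Set (Set Y)} (hβ : IsFiniteOpenCover β)
    (h : Refines β α) : covD α ≤ covD β := by
  obtain ⟨γ, hγ, hγβ, hord⟩ := hβ.exists_ord_eq_covD
  exact hord ▸ covD_le_ord hγ (hγβ.trans h)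

theorem covD_preimage_le {α : Set (Set Z)} (hα : IsFiniteOpenCover α) {f : Y → Z}
    (hf : Continuous f) : covD (preimage f '' α) ≤ covD α := by
  obtain ⟨β, hβ, hβα, hord⟩ := hα.exists_ord_eq_covD
  exact hord ▸ (covD_le_ord (hβ.preimage hf) (hβα.preimage f)).trans (ord_preimage_le hβ.finite f)

theorem covD_le_covD_preimage {α : Set (Set Z)} (hα : IsFiniteOpenCover α) {p : Y → Z}
    {s : Z → Y} (hp : Continuous p) (hs : Continuous s) (h : LeftInverse p s) :
    covD α ≤ covD (preimage p '' α) :=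
  calc covD α = covD (preimage s '' (preimage p '' α)) := by
        simp only [image_image, ← preimage_comp, h.comp_eq_id, preimage_id, image_id']
    _ ≤ covD (preimage p '' α) := covD_preimage_le (hα.preimage hp) hs

end CoveringNumber

section Overlaps

theorem ncard_overlaps_add_one_le {R ι κ : Type*} [LinearOrder R] {a a' : ι → R} {b b' : κ → R}
    {s : Set ι} {t : Set κ} (hs : s.Finite) (ht : t.Finite)
    (ha : s.PairwiseDisjoint fun i => Ico (a i) (a' i))
    (hb : t.PairwiseDisjoint fun j => Ico (b j) (b' j))
    {i₀ : ι} {j₀ : κ} (hi₀ : i₀ ∈ s) (hj₀ : j₀ ∈ t) (h₀ : a i₀ = b j₀) :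
    {p ∈ s ×ˢ t | (Ico (a p.1) (a' p.1) ∩ Ico (b p.2) (b' p.2)).Nonempty}.ncard + 1 ≤
      s.ncard + t.ncard := by
  -- An overlap is determined by its left end, which is a left end of one of the two intervals.
  set S := {p ∈ s ×ˢ t | (Ico (a p.1) (a' p.1) ∩ Ico (b p.2) (b' p.2)).Nonempty}
  let left : ι × κ → R := fun p => max (a p.1) (b p.2)
  have left_mem : ∀ p ∈ S, left p ∈ Ico (a p.1) (a' p.1) ∩ Ico (b p.2) (b' p.2) := by
    rintro p ⟨-, hp⟩
    rw [Ico_inter_Ico] at hp ⊢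
    exact left_mem_Ico.2 (nonempty_Ico.1 hp)
  have left_injOn : InjOn left S := fun p hp q hq hpq => Prod.ext
    (ha.elim_set hp.1.1 hq.1.1 _ (left_mem p hp).1 (hpq ▸ (left_mem q hq).1))
    (hb.elim_set hp.1.2 hq.1.2 _ (left_mem p hp).2 (hpq ▸ (left_mem q hq).2))
  have left_mapsTo : ∀ p ∈ S, left p ∈ a '' s ∪ b '' t := by
    rintro p ⟨⟨hp₁, hp₂⟩, -⟩
    rcases max_choice (a p.1) (b p.2) with h | h
    · exact .inl ⟨p.1, hp₁, h.symm⟩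
    · exact .inr ⟨p.2, hp₂, h.symm⟩
  have hS_le : S.ncard ≤ (a '' s ∪ b '' t).ncard :=
    ncard_le_ncard_of_injOn left left_mapsTo left_injOn ((hs.image a).union (ht.image b))
  have common_end : 0 < (a '' s ∩ b '' t).ncard :=
    (ncard_pos ((hs.image a).inter_of_left _)).2 ⟨a i₀, ⟨i₀, hi₀, rfl⟩, j₀, hj₀, h₀.symm⟩
  have := ncard_union_add_ncard_inter (a '' s) (b '' t) (hs.image a) (ht.image b)
  have := ncard_image_le hs (f := a)
  have := ncard_image_le ht (f := b)
  omega

variable {R ι κ : Type*} [AddCommMonoid R] [LinearOrder R] [LinearOrder ι]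
  [LocallyFiniteOrderBot ι] [LinearOrder κ] [LocallyFiniteOrderBot κ]

theorem exists_pos_sum_Iio_eq_zero [Finite ι] {c : ι → R} (hc : 0 ≤ c) (h : ∃ i, 0 < c i) :
    ∃ i, 0 < c i ∧ ∑ k ∈ Finset.Iio i, c k = 0 := by
  obtain ⟨i, hi⟩ := exists_minimal_of_wellFoundedLT _ h
  refine ⟨i, hi.prop, Finset.sum_eq_zero fun k hk => ?_⟩
  exact (hc k).eq_of_not_lt' (hi.not_prop_of_lt (Finset.mem_Iio.1 hk))

/-- The intervals of lengths `c i` stacked end to end from `0` upwards, in the order of the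
indices. -/
def stackedIco (c : ι → R) (i : ι) : Set R :=
  Ico (∑ k ∈ Finset.Iio i, c k) (∑ k ∈ Finset.Iic i, c k)

variable [IsOrderedCancelAddMonoid R]

theorem stackedIco_nonempty {c : ι → R} {i : ι} : (stackedIco c i).Nonempty ↔ 0 < c i := by
  rw [stackedIco, nonempty_Ico, ← Finset.Iio_insert, Finset.sum_insert Finset.notMem_Iio_self,
    lt_add_iff_pos_left]

theorem pairwise_disjoint_stackedIco {c : ι → R} (hc : 0 ≤ c) :
    Pairwise (Disjoint on stackedIco c) := by
  refine (pairwise_disjoint_on _).2 fun i j hij => Ico_disjoint_Ico.2 <|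
    (min_le_left _ _).trans <| le_trans ?_ (le_max_right _ _)
  exact Finset.sum_le_sum_of_subset_of_nonneg
    (fun k hk => Finset.mem_Iio.2 ((Finset.mem_Iic.1 hk).trans_lt hij)) fun k _ _ => hc k

theorem stackedIco_overlaps [Finite ι] [Finite κ] {c : ι → R} {d : κ → R} (hc : 0 ≤ c)
    (hd : 0 ≤ d) (hc' : ∃ i, 0 < c i) (hd' : ∃ j, 0 < d j) :
    {p : ι × κ | (stackedIco c p.1 ∩ stackedIco d p.2).Nonempty}.Nonempty ∧
    {p : ι × κ | (stackedIco c p.1 ∩ stackedIco d p.2).Nonempty}.ncard + 1 ≤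
      {i | 0 < c i}.ncard + {j | 0 < d j}.ncard := by
  obtain ⟨i₀, hi₀, hi₀'⟩ := exists_pos_sum_Iio_eq_zero hc hc'
  obtain ⟨j₀, hj₀, hj₀'⟩ := exists_pos_sum_Iio_eq_zero hd hd'
  have zero_mem_c : 0 ∈ stackedIco c i₀ := hi₀' ▸ left_mem_Ico.2
    (nonempty_Ico.1 (stackedIco_nonempty.2 hi₀))
  have zero_mem_d : 0 ∈ stackedIco d j₀ := hj₀' ▸ left_mem_Ico.2
    (nonempty_Ico.1 (stackedIco_nonempty.2 hj₀))
  refine ⟨⟨(i₀, j₀), 0, zero_mem_c, zero_mem_d⟩, ?_⟩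
  refine (Nat.add_le_add_right (ncard_le_ncard fun p hp => ?_) 1).trans <|
    ncard_overlaps_add_one_le (toFinite _) (toFinite _)
      ((pairwise_disjoint_stackedIco hc).set_pairwise _)
      ((pairwise_disjoint_stackedIco hd).set_pairwise _) hi₀ hj₀ (hi₀'.trans hj₀'.symm)
  exact ⟨⟨stackedIco_nonempty.1 hp.left, stackedIco_nonempty.1 hp.right⟩, hp⟩

end Overlaps

section Subadditivity

variable {Y : Type*} [TopologicalSpace Y]

theorem IsFiniteOpenCover.exists_partitionOfUnity [NormalSpace Y] {α : Set (Set Y)}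
    (hα : IsFiniteOpenCover α) :
    ∃ (n : ℕ) (f : PartitionOfUnity (Fin n) Y), (∀ i, ∃ U ∈ α, {x | 0 < f i x} ⊆ U) ∧
      ∀ x, ({i | 0 < f i x}.ncard : ℤ) ≤ ord α + 1 := by
  obtain ⟨n, U, hU, rfl⟩ := hα.finite.fin_param
  obtain ⟨f, hf⟩ := PartitionOfUnity.exists_isSubordinate_of_locallyFinite isClosed_univ U
    (fun i => hα.isOpen _ (mem_range_self i)) (locallyFinite_of_finite U)
    (by rw [← sUnion_range, hα.sUnion_eq])
  have hsub (i : Fin n) : {x | 0 < f i x} ⊆ U i := fun x hx => hf i (subset_tsupport _ hx.ne')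
  refine ⟨n, f, fun i => ⟨U i, mem_range_self i, hsub i⟩, fun x => ?_⟩
  refine le_trans (Nat.cast_le.2 ?_) (ncard_le_ord_add_one hα.finite x)
  exact ncard_le_ncard_of_injOn U (fun i hi => ⟨mem_range_self i, hsub i hi⟩) hU.injOn
    (hα.finite.subset (sep_subset _ _))

variable {n m : ℕ} (f : PartitionOfUnity (Fin n) Y) (g : PartitionOfUnity (Fin m) Y)

/-- The cover attached to two partitions of unity, indexed by pairs: the points at which the
interval of the first function overlaps the interval of the second when the values of each
partition are stacked to fill `[0, 1)`. -/
def overlap (p : Fin n × Fin m) : Set Y :=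
  {x | (stackedIco (fun i => f i x) p.1 ∩ stackedIco (fun j => g j x) p.2).Nonempty}

theorem isOpen_overlap (p : Fin n × Fin m) : IsOpen (overlap f g p) := by
  simp only [overlap, stackedIco, Ico_inter_Ico, nonempty_Ico]
  exact isOpen_lt (by fun_prop) (by fun_prop)

theorem overlap_subset (p : Fin n × Fin m) :
    overlap f g p ⊆ {x | 0 < f p.1 x} ∩ {x | 0 < g p.2 x} := fun _ hx =>
  ⟨stackedIco_nonempty.1 hx.left, stackedIco_nonempty.1 hx.right⟩

theorem overlaps_at (x : Y) :
    {p | x ∈ overlap f g p}.Nonempty ∧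
    {p | x ∈ overlap f g p}.ncard + 1 ≤ {i | 0 < f i x}.ncard + {j | 0 < g j x}.ncard :=
  stackedIco_overlaps (fun i => f.nonneg i x) (fun j => g.nonneg j x)
    (f.exists_pos (mem_univ x)) (g.exists_pos (mem_univ x))

theorem isFiniteOpenCover_overlap : IsFiniteOpenCover (range (overlap f g)) where
  finite := finite_range _
  isOpen := forall_mem_range.2 (isOpen_overlap f g)
  sUnion_eq := eq_univ_of_forall fun x =>
    let ⟨p, hp⟩ := (overlaps_at f g x).1
    ⟨_, mem_range_self p, hp⟩

theorem covD_join_le [NormalSpace Y] [Nonempty Y] {α β : Set (Set Y)}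
    (hα : IsFiniteOpenCover α) (hβ : IsFiniteOpenCover β) :
    covD (join α β) ≤ covD α + covD β := by
  obtain ⟨α', hα', hαr, hαord⟩ := hα.exists_ord_eq_covD
  obtain ⟨β', hβ', hβr, hβord⟩ := hβ.exists_ord_eq_covD
  obtain ⟨n, f, hf, hfcard⟩ := hα'.exists_partitionOfUnity
  obtain ⟨m, g, hg, hgcard⟩ := hβ'.exists_partitionOfUnity
  have refines : Refines (range (overlap f g)) (join α' β') := by
    rintro _ ⟨p, rfl⟩
    obtain ⟨U, hU, hfU⟩ := hf p.1
    obtain ⟨V, hV, hgV⟩ := hg p.2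
    exact ⟨U ∩ V, mem_image2_of_mem hU hV,
      (overlap_subset f g p).trans (inter_subset_inter hfU hgV)⟩
  have card_le (x : Y) : ({p | x ∈ overlap f g p}.ncard : ℤ) ≤ ord α' + ord β' + 1 := by
    have := (overlaps_at f g x).2
    have := hfcard x
    have := hgcard x
    omega
  have neg_one_le : -1 ≤ ord α' + ord β' := by
    have := card_le (Classical.arbitrary Y)
    omega
  rw [← hαord, ← hβord]
  exact (covD_le_ord (isFiniteOpenCover_overlap f g) (refines.trans (hαr.join hβr))).trans
    (ord_range_le neg_one_le card_le)

end Subadditivity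

section BoxCovers

variable {Y Z : Type*}

theorem exists_finite_ball_cover [UniformSpace Y] [CompactSpace Y] {V : SetRel Y Y}
    (hV : V ∈ 𝓤 Y) (hVo : IsOpen V) :
    ∃ t : Set Y, IsFiniteOpenCover ((fun y => UniformSpace.ball y V) '' t) := by
  obtain ⟨t, -, ht⟩ := isCompact_univ.elim_nhds_subcover (X := Y)
    (fun y => UniformSpace.ball y V) fun y _ => UniformSpace.ball_mem_nhds y hV
  refine ⟨t, t.finite_toSet.image _, forall_mem_image.2 fun y _ => UniformSpace.isOpen_ball y hVo,
    ?_⟩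
  rw [sUnion_image]
  exact univ_subset_iff.1 ht

variable [TopologicalSpace Y] [CompactSpace Y] [T2Space Y] [TopologicalSpace Z] [CompactSpace Z]
  [T2Space Z]

theorem IsFiniteOpenCover.exists_boxCover_refines {α : Set (Set (Y × Z))}
    (hα : IsFiniteOpenCover α) :
    ∃ β γ, IsFiniteOpenCover β ∧ IsFiniteOpenCover γ ∧ Refines (MeanDim.boxCover β γ) α := by
  let : UniformSpace Y := uniformSpaceOfCompactR1
  let : UniformSpace Z := uniformSpaceOfCompactR1
  obtain ⟨V, hV, hVα⟩ := lebesgue_number_lemma_sUnion isCompact_univ hα.isOpen hα.sUnion_eq.ge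
  obtain ⟨⟨V₁, V₂⟩, ⟨⟨hV₁, hV₁o⟩, hV₂, hV₂o⟩, hsub⟩ :=
    (uniformity_hasBasis_open.uniformity_prod uniformity_hasBasis_open).mem_iff.1 hV
  obtain ⟨s, hs⟩ := exists_finite_ball_cover hV₁ hV₁o
  obtain ⟨t, ht⟩ := exists_finite_ball_cover hV₂ hV₂o
  refine ⟨_, _, hs, ht, ?_⟩
  rintro _ ⟨_, ⟨y, -, rfl⟩, _, ⟨z, -, rfl⟩, rfl⟩
  obtain ⟨A, hA, hyzA⟩ := hVα (y, z) (mem_univ _)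
  exact ⟨A, hA, fun q hq => hyzA (hsub hq)⟩

theorem covD_boxCover_le [Nonempty (Y × Z)] {β : Set (Set Y)} {γ : Set (Set Z)}
    (hβ : IsFiniteOpenCover β) (hγ : IsFiniteOpenCover γ) :
    covD (boxCover β γ) ≤ covD β + covD γ := by
  rw [boxCover_eq_join]
  exact (covD_join_le (hβ.preimage continuous_fst) (hγ.preimage continuous_snd)).trans
    (add_le_add (covD_preimage_le hβ continuous_fst) (covD_preimage_le hγ continuous_snd))

end BoxCovers

section Dimension

variable {Y Z : Type*} [TopologicalSpace Y] [TopologicalSpace Z]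

theorem covD_le_topDim {α : Set (Set Y)} (hα : IsFiniteOpenCover α) :
    ((covD α : ℝ) : EReal) ≤ topDim Y :=
  le_iSup₂_of_le α hα le_rfl

theorem topDim_le_of_leftInverse {p : Y → Z} {s : Z → Y} (hp : Continuous p)
    (hs : Continuous s) (h : LeftInverse p s) : topDim Z ≤ topDim Y :=
  iSup₂_le fun α hα => le_iSup₂_of_le (preimage p '' α) (hα.preimage hp) <| by
    exact_mod_cast covD_le_covD_preimage hα hp hs h

theorem topDim_prod_le [CompactSpace Y] [T2Space Y] [CompactSpace Z] [T2Space Z]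
    [Nonempty (Y × Z)] : topDim (Y × Z) ≤ topDim Y + topDim Z := by
  refine iSup₂_le fun α hα => ?_
  obtain ⟨β, γ, hβ, hγ, hr⟩ := hα.exists_boxCover_refines
  calc ((covD α : ℝ) : EReal) ≤ ((covD β : ℝ) : EReal) + ((covD γ : ℝ) : EReal) := by
        exact_mod_cast ((hβ.boxCover hγ).covD_le_of_refines hr).trans (covD_boxCover_le hβ hγ)
    _ ≤ topDim Y + topDim Z := add_le_add (covD_le_topDim hβ) (covD_le_topDim hγ)

theorem topDim_le_zero_of_subsingleton [Subsingleton Y] : topDim Y ≤ 0 := by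
  refine iSup₂_le fun α hα => ?_
  suffices covD α ≤ 0 by exact_mod_cast this
  rcases isEmpty_or_nonempty Y with hY | ⟨⟨y⟩⟩
  · exact (covD_le_ord hα (.refl α)).trans (ord_le_of_forall (by norm_num) hY.elim)
  · obtain ⟨U, hU, hyU⟩ := hα.exists_mem y
    have refines : Refines {univ} α := by
      rintro _ rfl
      exact ⟨U, hU, fun x _ => Subsingleton.elim y x ▸ hyU⟩
    refine (covD_le_ord isFiniteOpenCover_univ refines).trans
      (ord_le_of_forall (by norm_num) fun x => ?_)
    exact_mod_cast (ncard_le_ncard (sep_subset _ _)).trans (ncard_singleton (univ : Set Y)).le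

theorem topDim_pi_lt_top [CompactSpace Y] [T2Space Y] [Nonempty Y] (hY : topDim Y < ⊤)
    (ι : Type*) [Finite ι] : topDim (ι → Y) < ⊤ := by
  induction ι using Finite.induction_empty_option with
  | of_equiv e ih =>
    let h := Homeomorph.piCongrLeft (Y := fun _ => Y) e
    exact (topDim_le_of_leftInverse h.continuous h.symm.continuous h.right_inv).trans_lt ih
  | h_empty => exact topDim_le_zero_of_subsingleton.trans_lt EReal.zero_lt_top
  | @h_option ι _ ih =>
    let cons : Y × (ι → Y) → Option ι → Y := fun q o => o.elim q.1 q.2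
    let uncons : (Option ι → Y) → Y × (ι → Y) := fun f => (f none, fun i => f (some i))
    have cons_continuous : Continuous cons := continuous_pi fun o => by
      cases o <;> simp only [cons, Option.elim] <;> fun_prop
    have cons_uncons : LeftInverse cons uncons := fun f => funext fun o => by cases o <;> rfl
    calc topDim (Option ι → Y) ≤ topDim (Y × (ι → Y)) :=
          topDim_le_of_leftInverse cons_continuous (by fun_prop) cons_uncons
      _ ≤ topDim Y + topDim (ι → Y) := topDim_prod_le
      _ < ⊤ := EReal.add_lt_top hY.ne ih.ne

end Dimension

section MeanDimension

variable {Y Z : Type*} [TopologicalSpace Y] [TopologicalSpace Z]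

/-- The growth rate `mdim(φ, α) = lim 𝒟(α_0^{n-1}) / n` of a single cover,
written as an upper limit as in `mdim`. -/
noncomputable def mdimCover (φ : Y → Y) (α : Set (Set Y)) : EReal :=
  limsup (fun n : ℕ => (((covD (dynJoin φ α n) : ℝ) / (n : ℝ) : ℝ) : EReal)) atTop

theorem mdimCover_le_mdim (φ : C(Y, Y)) {α : Set (Set Y)} (hα : IsFiniteOpenCover α) :
    mdimCover φ α ≤ mdim φ :=
  le_iSup₂_of_le α hα le_rfl

theorem mdim_le {φ : C(Y, Y)} {a : EReal} (h : ∀ α, IsFiniteOpenCover α → mdimCover φ α ≤ a) :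
    mdim φ ≤ a :=
  iSup₂_le h

theorem tendsto_coe_const_div_atTop (d : ℝ) :
    Tendsto (fun n : ℕ => ((d / n : ℝ) : EReal)) atTop (𝓝 0) :=
  (continuous_coe_real_ereal.tendsto' 0 0 EReal.coe_zero).comp
    (tendsto_const_div_atTop_nhds_zero_nat d)

theorem mdimCover_nonneg {φ : Y → Y} (hφ : Continuous φ) {α : Set (Set Y)}
    (hα : IsFiniteOpenCover α) : 0 ≤ mdimCover φ α := by
  refine (tendsto_coe_const_div_atTop (-1)).limsup_eq.ge.trans
    (limsup_le_limsup (.of_forall fun n => EReal.coe_le_coe_iff.2 ?_))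
  gcongr
  exact_mod_cast (hα.dynJoin hφ n).neg_one_le_covD

theorem mdimCover_nonpos_of_bounded {φ : Y → Y} {α : Set (Set Y)} {d : ℝ}
    (h : ∀ n, covD (dynJoin φ α n) ≤ d) : mdimCover φ α ≤ 0 := by
  refine (limsup_le_limsup (.of_forall fun n => EReal.coe_le_coe_iff.2 ?_)).trans
    (tendsto_coe_const_div_atTop d).limsup_eq.le
  gcongr
  exact h n

theorem mdim_nonneg (φ : C(Y, Y)) : 0 ≤ mdim φ :=
  (mdimCover_nonneg φ.continuous isFiniteOpenCover_univ).trans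
    (mdimCover_le_mdim φ isFiniteOpenCover_univ)

theorem mdim_id : mdim (ContinuousMap.id Y) = 0 :=
  le_antisymm (mdim_le fun α hα => mdimCover_nonpos_of_bounded fun n =>
    Int.cast_le.2 (hα.covD_le_of_refines (refines_dynJoin_id α n))) (mdim_nonneg _)

theorem mdim_eq_zero_of_topDim_lt_top (hY : topDim Y < ⊤) (φ : C(Y, Y)) : mdim φ = 0 := by
  obtain ⟨d, hd, -⟩ := EReal.lt_iff_exists_real_btwn.1 hY
  refine le_antisymm (mdim_le fun α hα => mdimCover_nonpos_of_bounded (d := d) fun n => ?_)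
    (mdim_nonneg φ)
  exact EReal.coe_le_coe_iff.1 ((covD_le_topDim (hα.dynJoin φ.continuous n)).trans hd.le)

theorem mdim_le_of_semiconj_of_leftInverse {φ : C(Y, Y)} {ψ : C(Z, Z)} {p : Y → Z} {s : Z → Y}
    (hp : Continuous p) (hs : Continuous s) (hps : LeftInverse p s) (h : Semiconj p φ ψ) :
    mdim ψ ≤ mdim φ := by
  refine mdim_le fun α hα => le_trans ?_ (mdimCover_le_mdim φ (hα.preimage hp))
  refine limsup_le_limsup (.of_forall fun n => EReal.coe_le_coe_iff.2 ?_)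
  rw [dynJoin_preimage h]
  gcongr
  exact covD_le_covD_preimage (hα.dynJoin ψ.continuous n) hp hs hps

theorem mdim_eq_of_semiconj {φ : C(Y, Y)} {ψ : C(Z, Z)} (e : Y ≃ₜ Z) (h : Semiconj e φ ψ) :
    mdim φ = mdim ψ :=
  le_antisymm
    (mdim_le_of_semiconj_of_leftInverse e.symm.continuous e.continuous e.left_inv
      (h.inverse_left e.left_inv e.right_inv))
    (mdim_le_of_semiconj_of_leftInverse e.continuous e.symm.continuous e.right_inv h)

variable [CompactSpace Y] [T2Space Y] [CompactSpace Z] [T2Space Z]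

theorem mdim_prodMap_le [Nonempty (Y × Z)] (φ : C(Y, Y)) (ψ : C(Z, Z)) :
    mdim (φ.prodMap ψ) ≤ mdim φ + mdim ψ := by
  refine mdim_le fun α hα => ?_
  obtain ⟨β, γ, hβ, hγ, hr⟩ := hα.exists_boxCover_refines
  have covD_le (n : ℕ) : covD (dynJoin (φ.prodMap ψ) α n) ≤
      covD (dynJoin φ β n) + covD (dynJoin ψ γ n) :=
    have hβn := hβ.dynJoin φ.continuous n
    have hγn := hγ.dynJoin ψ.continuous n
    ((hβn.boxCover hγn).covD_le_of_refines
      ((boxCover_dynJoin_refines β γ φ ψ n).trans (hr.dynJoin _ n))).trans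
        (covD_boxCover_le hβn hγn)
  have hβ0 : mdimCover φ β ≠ ⊥ :=
    (EReal.bot_lt_zero.trans_le (mdimCover_nonneg φ.continuous hβ)).ne'
  have hγ0 : mdimCover ψ γ ≠ ⊥ :=
    (EReal.bot_lt_zero.trans_le (mdimCover_nonneg ψ.continuous hγ)).ne'
  calc mdimCover (φ.prodMap ψ) α ≤ mdimCover φ β + mdimCover ψ γ := by
        refine le_trans (limsup_le_limsup (.of_forall fun n => ?_))
          (EReal.limsup_add_le (.inl hβ0) (.inr hγ0))
        rw [Pi.add_apply, ← EReal.coe_add, EReal.coe_le_coe_iff, ← add_div]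
        gcongr
        exact_mod_cast covD_le n
    _ ≤ mdim φ + mdim ψ := add_le_add (mdimCover_le_mdim φ hβ) (mdimCover_le_mdim ψ hγ)

theorem mdim_prodMap_of_topDim_lt_top [Nonempty Y] [Nonempty Z] (hY : topDim Y < ⊤)
    (φ : C(Y, Y)) (ψ : C(Z, Z)) : mdim (φ.prodMap ψ) = mdim ψ := by
  inhabit Y
  refine le_antisymm ?_ (mdim_le_of_semiconj_of_leftInverse continuous_snd
    (Continuous.prodMk_right default) (fun _ => rfl) fun _ => rfl)
  simpa only [mdim_eq_zero_of_topDim_lt_top hY φ, zero_add] using mdim_prodMap_le φ ψ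

end MeanDimension

section Approximation

variable {K : Type*}

open Classical in
/-- The map that keeps the coordinates of `x` in `E` and replaces all others by those of `x₀`. -/
noncomputable def truncate {X : K → Type*} [∀ k, TopologicalSpace (X k)] (x₀ : ∀ k, X k)
    (E : Finset K) : C(∀ k, X k, ∀ k, X k) where
  toFun x := E.piecewise x x₀
  continuous_toFun := continuous_pi fun k => by
    by_cases hk : k ∈ E <;> simp only [Finset.piecewise, hk, if_true, if_false] <;> fun_prop

/-- The `k`-th coordinate of a continuous map into a product. -/
def coord {Y : Type*} [TopologicalSpace Y] {X : K → Type*} [∀ k, TopologicalSpace (X k)] (k : K)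
    (φ : C(Y, ∀ k, X k)) : C(Y, X k) :=
  (ContinuousMap.eval k).comp φ

theorem tendsto_iff_forall_coord {ι Y : Type*} [TopologicalSpace Y] [CompactSpace Y]
    {X : K → Type*} [∀ k, UniformSpace (X k)] {l : Filter ι} {F : ι → C(Y, ∀ k, X k)}
    {φ : C(Y, ∀ k, X k)} :
    Tendsto F l (𝓝 φ) ↔ ∀ k, Tendsto (fun i => coord k (F i)) l (𝓝 (coord k φ)) := by
  simp only [ContinuousMap.tendsto_iff_tendstoUniformly, tendstoUniformly_iff_tendsto,
    Pi.uniformity, tendsto_iInf, tendsto_comap_iff]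
  rfl

theorem tendsto_of_forall_mem_coord_eq {Y : Type*} [TopologicalSpace Y] [CompactSpace Y]
    {X : K → Type*} [∀ k, UniformSpace (X k)] {F G : Finset K → C(Y, ∀ k, X k)}
    {φ : C(Y, ∀ k, X k)} (hG : Tendsto G atTop (𝓝 φ))
    (h : ∀ E, ∀ k ∈ E, coord k (F E) = coord k (G E)) : Tendsto F atTop (𝓝 φ) := by
  refine tendsto_iff_forall_coord.2 fun k => (tendsto_iff_forall_coord.1 hG k).congr' ?_
  filter_upwards [eventually_ge_atTop {k}] with E hE
  exact (h E k (Finset.singleton_subset_iff.1 hE)).symm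

theorem tendsto_truncate {X : K → Type*} [∀ k, UniformSpace (X k)] [∀ k, CompactSpace (X k)]
    (x₀ : ∀ k, X k) : Tendsto (truncate x₀) atTop (𝓝 (.id _)) :=
  tendsto_of_forall_mem_coord_eq tendsto_const_nhds fun _ _ hk =>
    ContinuousMap.ext fun _ => if_pos hk

variable {X : Type*} [TopologicalSpace X]

theorem exists_homeomorph_prod_pi [Infinite K] (E : Finset K) :
    ∃ h : (K → X) ≃ₜ (E → X) × (K → X), ∀ x i, (h x).1 i = x i := by
  classical
  obtain ⟨e⟩ : Nonempty ({k // k ∉ E} ≃ K) :=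
    Cardinal.eq.1 (Cardinal.mk_compl_finset_of_infinite E)
  exact ⟨(Homeomorph.piEquivPiSubtypeProd (· ∈ E) fun _ => X).trans
    ((Homeomorph.refl _).prodCongr (Homeomorph.piCongrLeft (Y := fun _ => X) e)), fun _ _ => rfl⟩

variable [CompactSpace X] [T2Space X]

theorem exists_mdim_eq_and_coord_eq [Infinite K] [Nonempty X] (hX : topDim X < ⊤)
    (φ ψ : C(K → X, K → X)) (x₀ : K → X) (E : Finset K) :
    ∃ θ : C(K → X, K → X), mdim θ = mdim ψ ∧
      ∀ k ∈ E, coord k θ = coord k (φ.comp (truncate x₀ E)) := by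
  obtain ⟨h, hE⟩ := exists_homeomorph_prod_pi (X := X) E
  have h_symm (q : (E → X) × (K → X)) (i : E) : h.symm q i = q.1 i := by
    rw [← hE (h.symm q), h.apply_symm_apply]
  let T : C(E → X, E → X) :=
    ⟨fun u i => φ (truncate x₀ E (h.symm (u, x₀))) i, by fun_prop⟩
  let θ : C(K → X, K → X) := ⟨fun x => h.symm (T.prodMap ψ (h x)), by fun_prop⟩
  have mdim_θ : mdim θ = mdim (T.prodMap ψ) :=
    mdim_eq_of_semiconj h fun x => h.apply_symm_apply _
  refine ⟨θ, mdim_θ.trans (mdim_prodMap_of_topDim_lt_top (topDim_pi_lt_top hX E) T ψ),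
    fun k hk => ContinuousMap.ext fun x => (h_symm _ ⟨k, hk⟩).trans ?_⟩
  have truncate_eq : truncate x₀ E (h.symm ((h x).1, x₀)) = truncate x₀ E x := by
    classical
    exact E.piecewise_congr (fun i hi => (h_symm _ ⟨i, hi⟩).trans (hE x ⟨i, hi⟩)) fun _ _ => rfl
  exact congrArg (fun y => φ y k) truncate_eq

theorem dense_mdim_eq [Infinite K] (hX : topDim X < ⊤) (ψ : C(K → X, K → X)) :
    Dense {φ : C(K → X, K → X) | mdim φ = mdim ψ} := by
  intro φ
  rcases isEmpty_or_nonempty X with hX' | hX'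
  · have hφψ : φ = ψ := ContinuousMap.ext fun x => isEmptyElim (x (Classical.arbitrary K))
    exact subset_closure (congrArg mdim hφψ)
  let x₀ : K → X := Classical.arbitrary _
  choose θ mdim_θ coord_θ using exists_mdim_eq_and_coord_eq hX φ ψ x₀
  let : UniformSpace X := uniformSpaceOfCompactR1
  have tendsto_comp : Tendsto (fun E => φ.comp (truncate x₀ E)) atTop (𝓝 φ) :=
    (φ.continuous_postcomp.tendsto (.id _)).comp (tendsto_truncate x₀)
  exact mem_closure_of_tendsto (tendsto_of_forall_mem_coord_eq tendsto_comp coord_θ)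
    (.of_forall mdim_θ)

theorem eq_of_continuousAt_of_dense {A B : Type*} [TopologicalSpace A] [TopologicalSpace B]
    [T2Space B] {f : A → B} {x : A} {b : B} (h : ContinuousAt f x) (hb : Dense {y | f y = b}) :
    f x = b :=
  tendsto_nhds_unique_of_frequently_eq h tendsto_const_nhds (mem_closure_iff_frequently.1 (hb x))

end Approximation

end MeanDim

theorem theorem5p5_general {X : Type*} [TopologicalSpace X] [CompactSpace X] [T2Space X]
    (hX : MeanDim.topDim X < ⊤) (K : Type*) [Infinite K] :
    Dense {φ : C(K → X, K → X) | MeanDim.mdim φ = 0} ∧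
    (∀ a : EReal, (∃ ψ : C(K → X, K → X), MeanDim.mdim ψ = a) →
      Dense {φ : C(K → X, K → X) | MeanDim.mdim φ = a}) ∧
    ((∃ c : EReal, ∀ φ : C(K → X, K → X), MeanDim.mdim φ = c) ∨
      (∀ φ : C(K → X, K → X),
        ¬ ContinuousAt (fun θ : C(K → X, K → X) => MeanDim.mdim θ) φ)) := by
  have dense (ψ : C(K → X, K → X)) :
      Dense {φ : C(K → X, K → X) | MeanDim.mdim φ = MeanDim.mdim ψ} :=
    MeanDim.dense_mdim_eq hX ψ
  have dense_zero : Dense {φ : C(K → X, K → X) | MeanDim.mdim φ = 0} :=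
    MeanDim.mdim_id (Y := K → X) ▸ dense (.id _)
  refine ⟨dense_zero, fun a ⟨ψ, hψ⟩ => hψ ▸ dense ψ, or_iff_not_imp_right.2 fun h => ?_⟩
  push Not at h
  obtain ⟨φ, hφ⟩ := h
  exact ⟨MeanDim.mdim φ, fun ψ => (MeanDim.eq_of_continuousAt_of_dense hφ (dense ψ)).symm⟩

/-- `X^𝕂` is `𝕂 → X` with the product topology, and `C⁰(X^𝕂)` is `C(𝕂 → X, 𝕂 → X)` with the
compact-open topology, which is the topology of uniform convergence since `X^𝕂` is compact. -/
theorem theorem5p5 {X : Type*} [MetricSpace X] [CompactSpace X]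
    (hX : MeanDim.topDim X < ⊤) (K : Type) (hK : K = ℕ ∨ K = ℤ) :
    Dense {φ : C(K → X, K → X) | MeanDim.mdim φ = 0} ∧
    (∀ a : EReal, (∃ ψ : C(K → X, K → X), MeanDim.mdim ψ = a) →
      Dense {φ : C(K → X, K → X) | MeanDim.mdim φ = a}) ∧
    ((∃ c : EReal, ∀ φ : C(K → X, K → X), MeanDim.mdim φ = c) ∨
      (∀ φ : C(K → X, K → X),
        ¬ ContinuousAt (fun θ : C(K → X, K → X) => MeanDim.mdim θ) φ)) := by
  have : Infinite K := by rcases hK with rfl | rfl <;> infer_instance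
  exact theorem5p5_general hX K
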